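/- Let $W$ be uniform on $[0,1]$ and, given $W=w$, let $X^n=(X_1,\dots,X_n)$ be i.i.d. Bernoulli($w$), where $n\ge 1$. Let $$R_B=\inf_{\phi}\ \mathbb E\,|W-\phi(X^n)|$$ be the Bayesian risk for the absolute loss, the infimum being over all functions $\phi:\{0,1\}^n\to\mathbb R$. Let $\chi^2(W,X^n)=\int\left(\frac{dP_{WX^n}}{d(P_W\otimes P_{X^n})}-1\right)^2 d(P_W\otimes P_{X^n})$ be the $\chi^2$-mutual information, and let $$\mathcal L(W\!\to\! X^n)=\sup_{U-W-X^n-\hat U}\log\frac{\mathbb P(U=\hat U)}{\max_u \mathbb P(U=u)}$$ be the maximal leakage, the supremum being over all Markov chains $U-W-X^n-\hat U$ with $U,\hat U$ in a common finite alphabet. Then for every $n\ge 1$: 1. $\displaystyle \chi^2(W,X^n)+1=\frac{n+1}{2n+1}\cdot\frac{4^n}{\binom{2n}{n}}\le\frac{16\sqrt{\pi n}}{21}$; 2. $\displaystyle R_B\ \ge\ \frac{2}{27}\cdot\frac{1}{\chi^2(W,X^n)+1}\ \ge\ \frac{7}{72\sqrt{\pi n}}$; 3. $\displaystyle \mathcal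 L(W\!\to\! X^n)\le\log\left(2+\sqrt{\pi n/2}\right)$ and $\displaystyle R_B\ \ge\ \frac{1}{8\left(2+\sqrt{\pi n/2}\right)}$; 4. the sample mean $\hat W=\frac1n\sum_{i=1}^n X_i$ satisfies $\mathbb E|W-\hat W|\le \frac{1}{\sqrt{6n}}$, so that $\displaystyle R_B\le\frac{1}{\sqrt{6n}}$. Moreover, both lower bounds match the upper bound up to constants: there is a constant $c>0$, independent of $n$, such that for all $n\ge1$ $$\frac{7}{72\sqrt{\pi n}}\ge\frac{c}{\sqrt{6n}}\qquad\text{and}\qquad \frac{1}{8\left(2+\sqrt{\pi n/2}\right)}\ge\frac{c}{\sqrt{6n}}.$$ -/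

import Mathlib

open MeasureTheory ProbabilityTheory unitInterval
open scoped ENNReal

/-- The Bayesian risk `R_B = inf_φ E[ℓ(W, φ(X))]`, where `W ∼ π`, `X ∣ W = w ∼ P w`, and the
infimum is over all measurable (non-randomised) estimators `φ`. -/
noncomputable def bayesianRisk {Θ 𝓧 𝓨 : Type*} [MeasurableSpace Θ] [MeasurableSpace 𝓧]
    [MeasurableSpace 𝓨] (ℓ : Θ → 𝓨 → ℝ≥0∞) (π : Measure Θ) (P : Kernel Θ 𝓧) : ℝ≥0∞ :=
  ⨅ (φ : 𝓧 → 𝓨) (_ : Measurable φ), ∫⁻ z, ℓ z.1 (φ z.2) ∂(π ⊗ₘ P)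

open scoped Classical in
/-- Pearson's `χ²`-divergence `∫ (dμ/dν - 1)² dν` (infinite unless `μ ≪ ν`). -/
noncomputable def chiSqDiv {α : Type*} [MeasurableSpace α] (μ ν : Measure α) : ℝ≥0∞ :=
  if μ ≪ ν then ∫⁻ a, ENNReal.ofReal (((μ.rnDeriv ν a).toReal - 1) ^ 2) ∂ν else ∞

/-- The `χ²`-mutual information of a joint law: the `χ²`-divergence of the joint law from the
product of its marginals. -/
noncomputable def chiSqInfo {α β : Type*} [MeasurableSpace α] [MeasurableSpace β]
    (J : Measure (α × β)) : ℝ≥0∞ :=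
  chiSqDiv J (J.fst.prod J.snd)

/-- The maximal leakage from `W ∼ π` to `X` (with `X ∣ W = w ∼ P w`):
the supremum of `log (ℙ(U = Û) / max_u ℙ(U = u))` over all Markov chains `U - W - X - Û` with `U`
and `Û` in a common finite alphabet. Such a chain is given by the conditional law `K` of `U`
given `W` and the conditional law `D` of `Û` given `X`; given `W`, the variables `U` and `Û`
are independent with laws `K` and `D ∘ₖ P`. -/
noncomputable def maximalLeakage {Θ 𝓧 : Type*} [MeasurableSpace Θ] [MeasurableSpace 𝓧]
    (π : Measure Θ) (P : Kernel Θ 𝓧) : EReal :=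
  ⨆ (m : ℕ) (K : Kernel Θ (Fin m)) (_ : IsMarkovKernel K)
    (D : Kernel 𝓧 (Fin m)) (_ : IsMarkovKernel D),
    ENNReal.log ((((K ×ₖ (D ∘ₖ P)) ∘ₘ π) {p | p.1 = p.2}) / ⨆ u : Fin m, (K ∘ₘ π) {u})

instance isProbabilityMeasure_bernoulli_bool (w : I) :
    IsProbabilityMeasure (bernoulliMeasure true false w) :=
  ⟨bernoulliMeasure_apply_of_mem_of_mem w MeasurableSet.univ trivial trivial⟩

theorem measurable_pi_bernoulli (n : ℕ) :
    Measurable fun w : I => Measure.pi fun _ : Fin n => bernoulliMeasure true false w := by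
  have hs : ∀ b : Bool, Measurable fun w : I => bernoulliMeasure true false w {b} := by
    intro b
    cases b
    · simp only [bernoulliMeasure_def, Measure.add_apply, Measure.smul_apply]
      simp [ENNReal.smul_def]
      fun_prop
    · simp only [bernoulliMeasure_def, Measure.add_apply, Measure.smul_apply]
      simp [ENNReal.smul_def]
      fun_prop
  refine Measure.measurable_of_measurable_coe _ fun s _ => ?_
  have h : ∀ w : I, (Measure.pi fun _ : Fin n => bernoulliMeasure true false w) s
      = ∑ x ∈ s.toFinite.toFinset, ∏ i, bernoulliMeasure true false w {x i} := by
    intro w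
    have := sum_measure_singleton (s := s.toFinite.toFinset)
      (μ := Measure.pi fun _ : Fin n => bernoulliMeasure true false w)
    rw [Set.Finite.coe_toFinset] at this
    rw [← this]
    exact Finset.sum_congr rfl fun x _ => Measure.pi_singleton _ x
  simp only [h]
  exact Finset.measurable_sum _ fun x _ => Finset.measurable_prod _ fun i _ => hs (x i)

/-- The law of `X^n = (X_1, …, X_n)` given `W = w`: i.i.d. Bernoulli(`w`), with `true` as `1`. -/
noncomputable def bernoulliSamples (n : ℕ) : Kernel I (Fin n → Bool) where
  toFun w := Measure.pi fun _ => bernoulliMeasure true false w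
  measurable' := measurable_pi_bernoulli n

instance isMarkovKernel_bernoulliSamples (n : ℕ) : IsMarkovKernel (bernoulliSamples n) :=
  ⟨fun w => inferInstanceAs
    (IsProbabilityMeasure (Measure.pi fun _ : Fin n => bernoulliMeasure true false w))⟩

/-- The joint law of `(W, X^n)`, where `W` is uniform on `[0,1]`. -/
noncomputable def bernoulliJoint (n : ℕ) : Measure (I × (Fin n → Bool)) :=
  (volume : Measure I) ⊗ₘ bernoulliSamples n

/-- The loss `ℓ(w, ŵ) = |w - ŵ|`. -/
noncomputable def absLoss (w : I) (v : ℝ) : ℝ≥0∞ := ENNReal.ofReal |(w : ℝ) - v|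

/-- The sample mean `(X_1 + ⋯ + X_n) / n`. -/
noncomputable def sampleMean (n : ℕ) (x : Fin n → Bool) : ℝ :=
  (∑ i, if x i then (1 : ℝ) else 0) / n

/-- The Bayesian risk of estimating the bias `W` from `X^n` under the loss `|w - ŵ|`. -/
noncomputable def bernoulliRisk (n : ℕ) : ℝ≥0∞ :=
  bayesianRisk absLoss (volume : Measure I) (bernoulliSamples n)

/-! Write `L x w` for the likelihood, `q x` for the marginal of the sample, `M x` for the maximum of
`L x` over `w`. All depend on `x` only through the number `k` of successes, so sums over samples
become binomial sums over `k`.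

Lower bounds: an estimator errs by less than `ρ` only if `W` lies in a ball of measure at most `2ρ`.
If `L x w ≤ G x w + c x`, this event has probability at most `∑ ∫ G + 2ρ ∑ c`, hence `R_B ≥ ρ (1 - ∑
∫ G - 2ρ ∑ c)` (`ofReal_le_bernoulliRisk_add`). The χ² bound takes `G` proportional to `L²/q` and
`c` to `q`; the leakage bound takes `G = 0`, `c = M`.

It remains to evaluate two sums. `∑ ∫ L²/q = χ² + 1` is a sum of Beta integrals, which reduces to
the convolution `∑ C(2i,i) C(2j,j) = 4^n`. `∑ M`, which also bounds the exponential of the leakage,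
is estimated by Stirling and a comparison with `∫ dx/√(x(n-x)) = π`. The upper bound on the risk is
the variance of the sample mean. -/

/-! ### Closed form and size of the χ² constant. -/

theorem sum_antidiagonal_centralBinom (n : ℕ) :
    ∑ p ∈ Finset.HasAntidiagonal.antidiagonal n, p.1.centralBinom * p.2.centralBinom = 4 ^ n := by
  -- Swapping the two indices shows that the weight `p.1` averages to `m / 2`. With the recurrence
  -- `(i+1) c_{i+1} = 2(2i+1) c_i` this gives `(n+1) S_{n+1} = 4 (n+1) S_n`.
  have key : ∀ m : ℕ, 2 * ∑ p ∈ Finset.HasAntidiagonal.antidiagonal m,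
      p.1 * (p.1.centralBinom * p.2.centralBinom) =
      m * ∑ p ∈ Finset.HasAntidiagonal.antidiagonal m, p.1.centralBinom * p.2.centralBinom := by
    intro m
    have hs : ∑ p ∈ Finset.HasAntidiagonal.antidiagonal m, p.1 * (p.1.centralBinom * p.2.centralBinom) =
        ∑ p ∈ Finset.HasAntidiagonal.antidiagonal m, p.2 * (p.1.centralBinom * p.2.centralBinom) := by
      rw [← Finset.Nat.sum_antidiagonal_swap]
      exact Finset.sum_congr rfl fun p _ => by simp [mul_comm]
    rw [two_mul]
    nth_rewrite 2 [hs]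
    rw [← Finset.sum_add_distrib, Finset.mul_sum]
    refine Finset.sum_congr rfl fun p hp => ?_
    rw [← Finset.HasAntidiagonal.mem_antidiagonal.1 hp]
    ring
  induction n with
  | zero => simp
  | succ n ih =>
    have h1 := key (n + 1)
    rw [Finset.Nat.sum_antidiagonal_succ] at h1
    have h2 : ∑ p ∈ Finset.HasAntidiagonal.antidiagonal n,
        (p.1 + 1) * ((p.1 + 1).centralBinom * p.2.centralBinom) =
        2 * (2 * ∑ p ∈ Finset.HasAntidiagonal.antidiagonal n, p.1 * (p.1.centralBinom * p.2.centralBinom)) +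
        2 * ∑ p ∈ Finset.HasAntidiagonal.antidiagonal n, p.1.centralBinom * p.2.centralBinom := by
      simp only [Finset.mul_sum]
      rw [← Finset.sum_add_distrib]
      refine Finset.sum_congr rfl fun p _ => ?_
      rw [← mul_assoc, Nat.succ_mul_centralBinom_succ]
      ring
    simp only [zero_mul, zero_add] at h1
    rw [h2, key n, ih] at h1
    refine Nat.eq_of_mul_eq_mul_left n.succ_pos ?_
    rw [Nat.succ_eq_add_one, ← h1]
    ring

theorem intervalIntegral_pow_mul_one_sub_pow (a b : ℕ) :
    ∫ x in (0 : ℝ)..1, x ^ a * (1 - x) ^ b =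
      (a.factorial * b.factorial : ℝ) / ((a + b + 1).factorial : ℝ) := by
  induction b generalizing a with
  | zero =>
    simp [Nat.factorial_succ]
    have : (a.factorial : ℝ) ≠ 0 := by positivity
    field_simp
  | succ b ih =>
    -- Integration by parts: this function vanishes at both endpoints, so its derivative integrates
    -- to zero.
    have hd : ∀ x ∈ Set.uIcc (0 : ℝ) 1, HasDerivAt (fun x : ℝ => x ^ (a + 1) * (1 - x) ^ (b + 1))
        ((a + 1) * (x ^ a * (1 - x) ^ (b + 1)) - (b + 1) * (x ^ (a + 1) * (1 - x) ^ b)) x := by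
      intro x _
      have h1 : HasDerivAt (fun x : ℝ => 1 - x) (-1) x := by
        simpa using (hasDerivAt_id x).const_sub 1
      convert! (hasDerivAt_pow (a + 1) x).mul (h1.pow (b + 1)) using 1
      simp
      ring
    have h := intervalIntegral.integral_eq_sub_of_hasDerivAt hd
      (Continuous.intervalIntegrable (by fun_prop) _ _)
    rw [intervalIntegral.integral_sub (Continuous.intervalIntegrable (by fun_prop) _ _)
      (Continuous.intervalIntegrable (by fun_prop) _ _),
      intervalIntegral.integral_const_mul, intervalIntegral.integral_const_mul, ih (a + 1)] at h
    have e : a + 1 + b + 1 = a + (b + 1) + 1 := by ring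
    rw [e] at h
    have ha : (a + 1 : ℝ) ≠ 0 := by positivity
    simp only [sub_self, ne_eq, Nat.succ_ne_zero, not_false_eq_true, zero_pow, mul_zero,
      zero_mul, Nat.factorial_succ a, Nat.cast_mul, Nat.cast_add, Nat.cast_one] at h
    rw [Nat.factorial_succ b]
    refine mul_left_cancel₀ ha ?_
    rw [sub_eq_zero.1 h]
    push_cast
    ring

/-- The chi-squared constant of the uniform-Bernoulli model, plus one. -/
theorem sum_choose_mul_beta (n : ℕ) :
    ∑ k ∈ Finset.range (n + 1), (n.choose k : ℝ) *
      ((((2 * k).factorial * (2 * (n - k)).factorial : ℝ) / ((2 * n + 1).factorial : ℝ)) /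
        ((k.factorial * (n - k).factorial : ℝ) / ((n + 1).factorial : ℝ))) =
      ((n : ℝ) + 1) / (2 * n + 1) * (4 ^ n / ((2 * n).choose n : ℝ)) := by
  have h4 : (4 : ℝ) ^ n = ∑ k ∈ Finset.range (n + 1),
      (k.centralBinom : ℝ) * ((n - k).centralBinom : ℝ) := by
    rw [← Finset.Nat.sum_antidiagonal_eq_sum_range_succ
      (fun i j => (i.centralBinom : ℝ) * (j.centralBinom : ℝ))]
    exact_mod_cast (sum_antidiagonal_centralBinom n).symm
  have hc : ∀ k : ℕ, (k.centralBinom : ℝ) = ((2 * k).factorial : ℝ) / (k.factorial * k.factorial) := by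
    intro k
    rw [Nat.centralBinom, Nat.cast_choose ℝ (by lia)]
    congr 4
    lia
  -- The identity now holds term by term: the `k`-th summand is `(n+1)/(2n+1) * c_k c_{n-k} / c_n`
  -- with `c` the central binomials.
  rw [h4, show (2 * n).choose n = n.centralBinom from rfl, Finset.sum_div, Finset.mul_sum]
  refine Finset.sum_congr rfl fun k hk => ?_
  have hk' : k ≤ n := by simpa [Nat.lt_succ_iff] using hk
  rw [hc, hc, hc, Nat.cast_choose ℝ hk', Nat.factorial_succ (2 * n), Nat.factorial_succ n]
  push_cast
  have := Nat.factorial_ne_zero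
  field_simp

theorem succ_div_mul_four_pow_div_choose_le {n : ℕ} (hn : 1 ≤ n) :
    ((n : ℝ) + 1) / (2 * n + 1) * (4 ^ n / ((2 * n).choose n : ℝ)) ≤
      16 * √(Real.pi * n) / 21 := by
  -- Equality at `n = 1`; the ratio of consecutive left sides is `2(n+2)/(2n+3) ≤ √((n+1)/n)`. Then
  -- `4/3 = (16/21)(7/4)` and `7/4 ≤ √π`.
  have key : ((n : ℝ) + 1) / (2 * n + 1) * (4 ^ n / ((2 * n).choose n : ℝ)) ≤ 4 / 3 * √n := by
    rw [show (2 * n).choose n = n.centralBinom from rfl]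
    induction n, hn using Nat.le_induction with
    | base => norm_num [Nat.centralBinom, Nat.choose]
    | succ n hn ih =>
      have hcp : (0 : ℝ) < n.centralBinom := by exact_mod_cast n.centralBinom_pos
      have hrec : ((n : ℝ) + 1) * (n + 1).centralBinom = 2 * (2 * n + 1) * n.centralBinom := by
        exact_mod_cast n.succ_mul_centralBinom_succ
      have hce : ((n + 1).centralBinom : ℝ) = 2 * (2 * n + 1) * n.centralBinom / (n + 1) := by
        rw [← hrec]; field_simp
      have hn' : (1 : ℝ) ≤ n := by exact_mod_cast hn
      have e : (((n + 1 : ℕ) : ℝ) + 1) / (2 * ((n + 1 : ℕ) : ℝ) + 1) *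
          (4 ^ (n + 1) / ((n + 1).centralBinom : ℝ)) =
          (((n : ℝ) + 1) / (2 * n + 1) * (4 ^ n / (n.centralBinom : ℝ))) *
            ((2 * (n + 2)) / (2 * n + 3)) := by
        rw [hce]
        push_cast
        have : (2 * ((n : ℝ) + 1) + 1) = 2 * n + 3 := by ring
        rw [this]
        field_simp
        ring
      rw [e]
      refine (mul_le_mul_of_nonneg_right ih (by positivity)).trans ?_
      rw [mul_assoc]
      refine mul_le_mul_of_nonneg_left ?_ (by norm_num)
      refine Real.le_sqrt_of_sq_le ?_
      rw [mul_pow, Real.sq_sqrt (by positivity), div_pow, mul_div_assoc', div_le_iff₀ (by positivity)]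
      push_cast
      nlinarith
  refine key.trans ?_
  rw [Real.sqrt_mul Real.pi_pos.le]
  have h74 : (7 / 4 : ℝ) ≤ √Real.pi :=
    Real.le_sqrt_of_sq_le (by linarith [Real.pi_gt_d2])
  nlinarith [Real.sqrt_nonneg (n : ℝ), mul_le_mul_of_nonneg_right h74 (Real.sqrt_nonneg (n : ℝ))]

/-! ### The sum of the maximised likelihoods. -/

/-- The maximum of `w ↦ w ^ a * (1 - w) ^ b` on the unit interval. -/
theorem pow_mul_one_sub_pow_le (a b : ℕ) {w : ℝ} (h0 : 0 ≤ w) (h1 : w ≤ 1) :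
    w ^ a * (1 - w) ^ b ≤ ((a : ℝ) / (a + b : ℕ)) ^ a * ((b : ℝ) / (a + b : ℕ)) ^ b := by
  have h1' : 0 ≤ 1 - w := by linarith
  rcases Nat.eq_zero_or_pos a with rfl | ha
  · rcases Nat.eq_zero_or_pos b with rfl | hb
    · simp
    · have : (b : ℝ) ≠ 0 := by positivity
      simpa [this] using pow_le_one₀ h1' (by linarith)
  rcases Nat.eq_zero_or_pos b with rfl | hb
  · have : (a : ℝ) ≠ 0 := by positivity
    simpa [this] using pow_le_one₀ h0 h1
  have ha' : (0 : ℝ) < a := by exact_mod_cast ha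
  have hb' : (0 : ℝ) < b := by exact_mod_cast hb
  push_cast
  set s : ℝ := a + b with hs
  have hsp : 0 < s := by positivity
  -- Weighted AM-GM, with points chosen so that the weighted mean is exactly 1; raising to the power
  -- `a + b` clears the fractional exponents.
  have h := Real.geom_mean_le_arith_mean2_weighted (w₁ := a / s) (w₂ := b / s)
    (p₁ := w * s / a) (p₂ := (1 - w) * s / b) (by positivity) (by positivity)
    (by positivity) (by positivity) (by field_simp; exact hs.symm)
  have e : a / s * (w * s / a) + b / s * ((1 - w) * s / b) = 1 := by field_simp; ring
  rw [e] at h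
  have h2 := pow_le_one₀ (n := a + b) (by positivity) h
  rw [mul_pow, ← Real.rpow_natCast, ← Real.rpow_natCast, ← Real.rpow_mul (by positivity),
    ← Real.rpow_mul (by positivity)] at h2
  have ea : a / s * ((a + b : ℕ) : ℝ) = (a : ℕ) := by push_cast; rw [← hs]; field_simp
  have eb : b / s * ((a + b : ℕ) : ℝ) = (b : ℕ) := by push_cast; rw [← hs]; field_simp
  rw [ea, eb, Real.rpow_natCast, Real.rpow_natCast] at h2
  calc w ^ a * (1 - w) ^ b
      = ((w * s / a) ^ a * ((1 - w) * s / b) ^ b) * ((a / s) ^ a * (b / s) ^ b) := by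
        rw [mul_mul_mul_comm, ← mul_pow, ← mul_pow]
        congr 2 <;> field_simp
    _ ≤ 1 * ((a / s) ^ a * (b / s) ^ b) := by gcongr
    _ = _ := one_mul _

/-- In Stirling form all powers cancel, leaving square roots times `s_n / (s_k s_{n-k})`, where `s`
is `stirlingSeq`. Since `s` decreases to `√π`, this is at most `1/√π`, with no error term. -/
theorem choose_mul_max_le {n k : ℕ} (hk : 1 ≤ k) (hkn : k < n) :
    (n.choose k : ℝ) * ((k / n : ℝ) ^ k * (((n - k : ℕ) : ℝ) / n) ^ (n - k)) ≤
      √(n / (2 * Real.pi)) * (1 / √(k * (n - k))) := by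
  obtain ⟨m, rfl⟩ := Nat.exists_eq_add_of_lt hkn
  set l := m + 1 with hl
  have hkl : k + m + 1 = k + l := by lia
  rw [hkl]
  have hkp : (0 : ℝ) < k := by exact_mod_cast hk
  have hlp : (0 : ℝ) < l := by positivity
  have hf : ∀ j : ℕ, 1 ≤ j →
      (j.factorial : ℝ) = Stirling.stirlingSeq j * (√(2 * j) * (j / Real.exp 1) ^ j) := by
    intro j hj
    have : (0 : ℝ) < j := by exact_mod_cast hj
    rw [Stirling.stirlingSeq, div_mul_cancel₀]
    positivity
  have hpos : ∀ j : ℕ, 1 ≤ j → 0 < Stirling.stirlingSeq j := by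
    intro j hj
    obtain ⟨i, rfl⟩ := Nat.exists_eq_add_of_le' hj
    exact Stirling.stirlingSeq'_pos i
  have hanti : Stirling.stirlingSeq (k + l) ≤ Stirling.stirlingSeq k := by
    obtain ⟨i, rfl⟩ := Nat.exists_eq_add_of_le' hk
    have := Stirling.stirlingSeq'_antitone (show i ≤ i + l by lia)
    simpa [Nat.succ_eq_add_one, add_right_comm] using this
  have hpi : √Real.pi ≤ Stirling.stirlingSeq l := Stirling.sqrt_pi_le_stirlingSeq (by lia)
  have hk0 := hpos k hk
  have hl0 := hpos l (by lia)
  have hn0 := hpos (k + l) (by lia)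
  have hsub : k + l - k = l := by lia
  rw [Nat.cast_choose ℝ (by lia), hsub, hf k hk, hf l (by lia), hf (k + l) (by lia)]
  have hcast : ((k + l : ℕ) : ℝ) - k = l := by push_cast; ring
  rw [hcast]
  have e : Stirling.stirlingSeq (k + l) * (√(2 * ((k + l : ℕ) : ℝ)) * (((k + l : ℕ) : ℝ) / Real.exp 1) ^ (k + l)) /
      (Stirling.stirlingSeq k * (√(2 * k) * (k / Real.exp 1) ^ k) *
        (Stirling.stirlingSeq l * (√(2 * l) * (l / Real.exp 1) ^ l))) *
      ((k / ((k + l : ℕ) : ℝ)) ^ k * (l / ((k + l : ℕ) : ℝ)) ^ l) =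
      (Stirling.stirlingSeq (k + l) / Stirling.stirlingSeq k) *
        (1 / Stirling.stirlingSeq l) * (√(2 * ((k + l : ℕ) : ℝ)) / (√(2 * k) * √(2 * l))) := by
    have : (0 : ℝ) < ((k + l : ℕ) : ℝ) := by positivity
    simp only [div_pow, pow_add]
    field_simp
  rw [e]
  have h1 : Stirling.stirlingSeq (k + l) / Stirling.stirlingSeq k ≤ 1 :=
    (div_le_one hk0).2 hanti
  have h2 : 1 / Stirling.stirlingSeq l ≤ 1 / √Real.pi :=
    one_div_le_one_div_of_le (Real.sqrt_pos.2 Real.pi_pos) hpi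
  calc _ ≤ 1 * (1 / √Real.pi) * (√(2 * ((k + l : ℕ) : ℝ)) / (√(2 * k) * √(2 * l))) := by
        gcongr
    _ = _ := by
        have hp := Real.pi_pos
        rw [Real.sqrt_div (by positivity), Real.sqrt_mul (by norm_num), Real.sqrt_mul (by norm_num),
          Real.sqrt_mul (by norm_num), Real.sqrt_mul (by norm_num), Real.sqrt_mul (by positivity)]
        field_simp

/-- AM-GM on the right side, combined with `(a² - t²)(b² - t²) ≤ (ab)²`. This is the midpoint
convexity of `1/√(x(n-x))` used below. -/
theorem two_div_sqrt_mul_le {a b t : ℝ} (ha : 0 < a) (hb : 0 < b) (hta : |t| < a) (htb : |t| < b) :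
    2 / √(a * b) ≤ 1 / √((a + t) * (b - t)) + 1 / √((a - t) * (b + t)) := by
  have ha2 := abs_lt.1 hta
  have hb2 := abs_lt.1 htb
  have p1 : 0 < (a + t) * (b - t) := mul_pos (by linarith) (by linarith)
  have p2 : 0 < (a - t) * (b + t) := mul_pos (by linarith) (by linarith)
  set u := 1 / √((a + t) * (b - t))
  set v := 1 / √((a - t) * (b + t))
  have hu : 0 ≤ u := by positivity
  have hv : 0 ≤ v := by positivity
  have hw : 0 ≤ 1 / √(a * b) := by positivity
  have hle : ((a + t) * (b - t)) * ((a - t) * (b + t)) ≤ (a * b) * (a * b) := by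
    have hA : 0 ≤ a ^ 2 - t ^ 2 := by nlinarith
    have hB : 0 ≤ b ^ 2 - t ^ 2 := by nlinarith
    nlinarith [mul_nonneg hA (sq_nonneg t), mul_nonneg (sq_nonneg a) (sq_nonneg t),
      mul_nonneg (sq_nonneg b) (sq_nonneg t)]
  have huv : (1 / √(a * b)) ^ 2 ≤ u * v := by
    have : √(((a + t) * (b - t)) * ((a - t) * (b + t))) ≤ a * b := by
      rw [← Real.sqrt_mul_self (mul_pos ha hb).le]
      exact Real.sqrt_le_sqrt hle
    rw [Real.sqrt_mul p1.le] at this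
    rw [div_pow, Real.sq_sqrt (by positivity), one_pow, div_mul_div_comm, one_mul]
    exact one_div_le_one_div_of_le (by positivity) this
  rw [show 2 / √(a * b) = 2 * (1 / √(a * b)) by ring]
  refine abs_le_of_sq_le_sq' ?_ (by positivity) |>.2
  nlinarith [sq_nonneg (u - v)]

theorem hasDerivAt_arcsin_two_mul_sub_div {n x : ℝ} (h0 : 0 < x) (h1 : x < n) :
    HasDerivAt (fun x => Real.arcsin ((2 * x - n) / n)) (1 / √(x * (n - x))) x := by
  have hn : 0 < n := h0.trans h1
  have hlin : HasDerivAt (fun x : ℝ => (2 * x - n) / n) (2 / n) x := by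
    simpa using (((hasDerivAt_id x).const_mul 2).sub_const n).div_const n
  have hne1 : (2 * x - n) / n ≠ -1 := by
    intro h
    rw [div_eq_iff hn.ne'] at h
    linarith
  have hne2 : (2 * x - n) / n ≠ 1 := by
    intro h
    rw [div_eq_iff hn.ne'] at h
    linarith
  convert! (Real.hasDerivAt_arcsin hne1 hne2).comp x hlin using 1
  have e : 1 - ((2 * x - n) / n) ^ 2 = (x * (n - x)) * (2 / n) ^ 2 := by
    field_simp
    ring
  have hp : 0 < x * (n - x) := mul_pos h0 (by linarith)
  rw [e, Real.sqrt_mul hp.le, Real.sqrt_sq (by positivity)]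
  have := Real.sqrt_pos.2 hp
  field_simp

/-- The midpoint rule underestimates the integral of a convex function. The integral over `[k-t,
k+t]`, written with the arcsine primitive, minus `2t` times the midpoint value is nondecreasing in
`t`; take `t = 1/2`. -/
theorem one_div_sqrt_le_arcsin_sub {n k : ℝ} (hk : 1 ≤ k) (hkn : k + 1 ≤ n) :
    1 / √(k * (n - k)) ≤ Real.arcsin ((2 * (k + 1 / 2) - n) / n) -
      Real.arcsin ((2 * (k - 1 / 2) - n) / n) := by
  have hd : ∀ t ∈ Set.Icc (0 : ℝ) (1 / 2), HasDerivAt (fun t =>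
      Real.arcsin ((2 * (k + t) - n) / n) - Real.arcsin ((2 * (k - t) - n) / n) -
        t * (2 / √(k * (n - k))))
      (1 / √((k + t) * (n - k - t)) + 1 / √((k - t) * (n - k + t)) - 2 / √(k * (n - k))) t := by
    intro t ht
    have h1 := (hasDerivAt_arcsin_two_mul_sub_div (n := n) (x := k + t)
      (by linarith [ht.1]) (by linarith [ht.2])).comp t ((hasDerivAt_id t).const_add k)
    have h2 := (hasDerivAt_arcsin_two_mul_sub_div (n := n) (x := k - t)
      (by linarith [ht.2]) (by linarith [ht.1])).comp t ((hasDerivAt_id t).const_sub k)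
    convert! (h1.sub h2).sub ((hasDerivAt_id t).mul_const (2 / √(k * (n - k)))) using 1
    rw [show n - (k + t) = n - k - t by ring, show n - (k - t) = n - k + t by ring]
    ring
  have hm := monotoneOn_of_deriv_nonneg (convex_Icc (0 : ℝ) (1 / 2))
    (fun t ht => (hd t ht).continuousAt.continuousWithinAt)
    (fun t ht => (hd t (interior_subset ht)).differentiableAt.differentiableWithinAt)
    (fun t ht => by
      have ht' := interior_subset ht
      rw [(hd t ht').deriv]
      have habs : |t| = t := abs_of_nonneg ht'.1
      have := two_div_sqrt_mul_le (a := k) (b := n - k) (t := t) (by linarith) (by linarith)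
        (by rw [habs]; linarith [ht'.2]) (by rw [habs]; linarith [ht'.2])
      linarith)
  have := hm (Set.left_mem_Icc.2 (by norm_num)) (Set.right_mem_Icc.2 (by norm_num))
    (by norm_num : (0 : ℝ) ≤ 1 / 2)
  simp only [add_zero, sub_zero, sub_self, zero_mul] at this
  have e : (1 / 2 : ℝ) * (2 / √(k * (n - k))) = 1 / √(k * (n - k)) := by ring
  linarith

theorem sum_one_div_sqrt_le_pi (n : ℕ) :
    ∑ k ∈ Finset.Ico 1 n, 1 / √((k : ℝ) * (n - k)) ≤ Real.pi := by
  rcases Nat.lt_or_ge n 1 with h | hn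
  · simp [Finset.Ico_eq_empty_of_le h.le, Real.pi_pos.le]
  let f : ℕ → ℝ := fun k => Real.arcsin ((2 * ((k : ℝ) - 1 / 2) - n) / n)
  have hle : ∀ k ∈ Finset.Ico 1 n, 1 / √((k : ℝ) * (n - k)) ≤ f (k + 1) - f k := by
    intro k hk
    rw [Finset.mem_Ico] at hk
    have := one_div_sqrt_le_arcsin_sub (n := n) (k := k) (by exact_mod_cast hk.1)
      (by exact_mod_cast hk.2)
    simpa only [f, Nat.cast_add, Nat.cast_one, show ((k : ℝ) + 1 - 1 / 2) = k + 1 / 2 by ring]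
      using this
  refine (Finset.sum_le_sum hle).trans ?_
  rw [Finset.sum_Ico_sub f hn]
  dsimp only [f]
  linarith [Real.arcsin_le_pi_div_two ((2 * ((n : ℝ) - 1 / 2) - n) / n),
    Real.neg_pi_div_two_le_arcsin ((2 * (((1 : ℕ) : ℝ) - 1 / 2) - n) / n)]

theorem sum_choose_mul_max_le {n : ℕ} (hn : 1 ≤ n) :
    ∑ k ∈ Finset.range (n + 1),
      (n.choose k : ℝ) * ((k / n : ℝ) ^ k * (((n - k : ℕ) : ℝ) / n) ^ (n - k)) ≤
      2 + √(Real.pi * n / 2) := by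
  have hn0 : (n : ℝ) ≠ 0 := by positivity
  -- The terms `k = 0` and `k = n` equal 1 each (as `0 ^ 0 = 1`) and make up the 2; Stirling handles
  -- the others.
  rw [Finset.sum_range_succ, Finset.range_eq_Ico, Finset.sum_eq_sum_Ico_succ_bot hn]
  have h : ∑ k ∈ Finset.Ico 1 n,
      (n.choose k : ℝ) * ((k / n : ℝ) ^ k * (((n - k : ℕ) : ℝ) / n) ^ (n - k)) ≤
      √(Real.pi * n / 2) := by
    calc _ ≤ ∑ k ∈ Finset.Ico 1 n, √(n / (2 * Real.pi)) * (1 / √(k * (n - k))) :=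
          Finset.sum_le_sum fun k hk =>
            choose_mul_max_le (Finset.mem_Ico.1 hk).1 (Finset.mem_Ico.1 hk).2
      _ ≤ √(n / (2 * Real.pi)) * Real.pi := by
          rw [← Finset.mul_sum]
          exact mul_le_mul_of_nonneg_left (sum_one_div_sqrt_le_pi n) (Real.sqrt_nonneg _)
      _ = √(Real.pi * n / 2) := by
          have hp := Real.pi_pos
          nth_rewrite 2 [← Real.sqrt_sq hp.le]
          rw [← Real.sqrt_mul (by positivity)]
          congr 1
          field_simp
  simp [hn0] at h ⊢
  linarith

/-! ### Likelihood, marginal law of the sample and their moments. -/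

/-- The number of successes in a sample. -/
def successCount {n : ℕ} (x : Fin n → Bool) : ℕ :=
  (Finset.univ.filter fun i => x i = true).card

theorem successCount_le {n : ℕ} (x : Fin n → Bool) : successCount x ≤ n := by
  simpa [successCount] using Finset.card_filter_le (Finset.univ : Finset (Fin n)) (x · = true)

/-- The likelihood of a Bernoulli sample. -/
def likelihood {n : ℕ} (x : Fin n → Bool) (w : ℝ) : ℝ :=
  w ^ successCount x * (1 - w) ^ (n - successCount x)

theorem likelihood_nonneg {n : ℕ} (x : Fin n → Bool) (w : I) : 0 ≤ likelihood x w := by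
  have h1 := w.2.1
  have h2 := sub_nonneg.2 w.2.2
  unfold likelihood
  positivity

theorem measurable_likelihood {n : ℕ} (x : Fin n → Bool) :
    Measurable fun w : I => likelihood x w := by
  unfold likelihood
  fun_prop

theorem sum_successCount {M : Type*} [AddCommMonoid M] (n : ℕ) (f : ℕ → M) :
    ∑ x : Fin n → Bool, f (successCount x) = ∑ k ∈ Finset.range (n + 1), n.choose k • f k := by
  have h := Finset.sum_powerset_apply_card f (x := (Finset.univ : Finset (Fin n)))
  rw [Finset.card_univ, Fintype.card_fin] at h
  rw [← h, Finset.powerset_univ]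
  refine Finset.sum_nbij' (fun x => Finset.univ.filter fun i => x i = true)
    (fun s i => decide (i ∈ s)) ?_ ?_ ?_ ?_ ?_ <;> simp [successCount]

theorem bernoulliSamples_singleton {n : ℕ} (x : Fin n → Bool) (w : I) :
    bernoulliSamples n w {x} = ENNReal.ofReal (likelihood x w) := by
  change Measure.pi (fun _ : Fin n => bernoulliMeasure true false w) {x} = _
  have hb : ∀ b : Bool, bernoulliMeasure true false w {b} =
      ENNReal.ofReal (if b = true then (w : ℝ) else 1 - w) := by
    intro b
    classical
    rw [bernoulliMeasure_apply _ (measurableSet_singleton b)]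
    cases b <;> simp [ENNReal.ofReal, Real.toNNReal_of_nonneg w.2.1,
      Real.toNNReal_of_nonneg (sub_nonneg.2 w.2.2)] <;> rfl
  have h1 := w.2.1
  have h2 := sub_nonneg.2 w.2.2
  rw [Measure.pi_singleton]
  simp only [hb]
  rw [← ENNReal.ofReal_prod_of_nonneg (fun i _ => by split_ifs <;> assumption),
    Finset.prod_ite, Finset.prod_const, Finset.prod_const, likelihood, successCount]
  congr 3
  have := Finset.card_filter_add_card_filter_not (s := (Finset.univ : Finset (Fin n))) (fun i => x i = true)
  rw [Finset.card_univ, Fintype.card_fin] at this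
  lia

theorem sum_likelihood {n : ℕ} (w : I) : ∑ x : Fin n → Bool, likelihood x w = 1 := by
  have := sum_successCount n fun k => (w : ℝ) ^ k * (1 - (w : ℝ)) ^ (n - k)
  simp only [likelihood]
  rw [this]
  have h := add_pow (w : ℝ) (1 - w) n
  rw [add_sub_cancel, one_pow] at h
  refine Eq.trans (Finset.sum_congr rfl fun k _ => ?_) h.symm
  rw [nsmul_eq_mul, mul_comm]

theorem lintegral_pow_mul_one_sub_pow (a b : ℕ) :
    ∫⁻ w : I, ENNReal.ofReal ((w : ℝ) ^ a * (1 - (w : ℝ)) ^ b) =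
      ENNReal.ofReal ((a.factorial * b.factorial : ℝ) / ((a + b + 1).factorial : ℝ)) := by
  rw [unitInterval.volume_def, lintegral_subtype_comap measurableSet_Icc
    (fun w : ℝ => ENNReal.ofReal (w ^ a * (1 - w) ^ b)),
    ← ofReal_integral_eq_lintegral_ofReal, ← intervalIntegral_pow_mul_one_sub_pow,
    intervalIntegral.integral_of_le zero_le_one, integral_Icc_eq_integral_Ioc]
  · exact (Continuous.continuousOn (by fun_prop)).integrableOn_Icc
  · filter_upwards [ae_restrict_mem measurableSet_Icc] with w hw
    have := hw.1
    have := sub_nonneg.2 hw.2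
    positivity

/-- The marginal probability of a sample. -/
noncomputable def evidence {n : ℕ} (x : Fin n → Bool) : ℝ :=
  ((successCount x).factorial * (n - successCount x).factorial : ℝ) / ((n + 1).factorial : ℝ)

theorem evidence_pos {n : ℕ} (x : Fin n → Bool) : 0 < evidence x := by
  unfold evidence
  positivity

theorem lintegral_likelihood {n : ℕ} (x : Fin n → Bool) :
    ∫⁻ w : I, ENNReal.ofReal (likelihood x w) = ENNReal.ofReal (evidence x) := by
  have := successCount_le x
  simp only [likelihood, lintegral_pow_mul_one_sub_pow, evidence]
  rw [show successCount x + (n - successCount x) + 1 = n + 1 by lia]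

theorem lintegral_likelihood_sq {n : ℕ} (x : Fin n → Bool) :
    ∫⁻ w : I, ENNReal.ofReal (likelihood x w ^ 2) =
      ENNReal.ofReal (((2 * successCount x).factorial * (2 * (n - successCount x)).factorial : ℝ) /
        ((2 * n + 1).factorial : ℝ)) := by
  have := successCount_le x
  simp only [likelihood, mul_pow, ← pow_mul', lintegral_pow_mul_one_sub_pow]
  rw [show 2 * successCount x + 2 * (n - successCount x) + 1 = 2 * n + 1 by lia]

theorem sum_lintegral_likelihood_sq_div (n : ℕ) :
    ∑ x : Fin n → Bool, (∫⁻ w : I, ENNReal.ofReal (likelihood x w ^ 2)) /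
      ENNReal.ofReal (evidence x) =
      ENNReal.ofReal (((n : ℝ) + 1) / (2 * n + 1) * (4 ^ n / ((2 * n).choose n : ℝ))) := by
  rw [← sum_choose_mul_beta]
  simp only [lintegral_likelihood_sq, ← ENNReal.ofReal_div_of_pos (evidence_pos _)]
  rw [← ENNReal.ofReal_sum_of_nonneg (fun x _ => div_nonneg (by positivity) (evidence_pos x).le)]
  congr 1
  refine (sum_successCount n fun k =>
    (((2 * k).factorial * (2 * (n - k)).factorial : ℝ) / ((2 * n + 1).factorial : ℝ)) /
      ((k.factorial * (n - k).factorial : ℝ) / ((n + 1).factorial : ℝ))).trans ?_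
  exact Finset.sum_congr rfl fun k _ => nsmul_eq_mul _ _

theorem lintegral_bernoulliJoint {n : ℕ} {f : I × (Fin n → Bool) → ℝ≥0∞} (hf : Measurable f) :
    ∫⁻ z, f z ∂(bernoulliJoint n) =
      ∑ x, ∫⁻ w : I, f (w, x) * ENNReal.ofReal (likelihood x w) := by
  rw [bernoulliJoint, Measure.lintegral_compProd hf, ← lintegral_finsetSum]
  · simp only [lintegral_fintype, bernoulliSamples_singleton]
  · intro x _
    exact (hf.comp measurable_prodMk_right).mul (measurable_likelihood x).ennreal_ofReal

theorem sum_ofReal_likelihood {n : ℕ} (w : I) :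
    ∑ x : Fin n → Bool, ENNReal.ofReal (likelihood x w) = 1 := by
  rw [← ENNReal.ofReal_sum_of_nonneg fun x _ => likelihood_nonneg x w, sum_likelihood,
    ENNReal.ofReal_one]

/-! ### Small-ball lower bounds for the risk. -/

theorem volume_abs_sub_lt_le (v ρ : ℝ) :
    volume {w : I | |(w : ℝ) - v| < ρ} ≤ ENNReal.ofReal (2 * ρ) := by
  rw [unitInterval.volume_apply, ← Real.volume_ball v ρ]
  refine measure_mono ?_
  rintro _ ⟨w, hw, rfl⟩
  simpa [Real.dist_eq] using hw

theorem measurable_absLoss_estimator {n : ℕ} (φ : (Fin n → Bool) → ℝ) :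
    Measurable fun z : I × (Fin n → Bool) => absLoss z.1 (φ z.2) := by
  have hφ : Measurable φ := Measurable.of_discrete
  unfold absLoss
  have h : Measurable fun z : I × (Fin n → Bool) => (z.1 : ℝ) - φ z.2 :=
    (measurable_subtype_coe.comp measurable_fst).sub (hφ.comp measurable_snd)
  exact (continuous_abs.measurable.comp h).ennreal_ofReal

/-- A small-ball lower bound for the risk: the likelihood is dominated by `G x w + c x`. -/
theorem ofReal_le_bernoulliRisk_add {n : ℕ} {ρ : ℝ} (G : (Fin n → Bool) → I → ℝ≥0∞)
    (hG : ∀ x, Measurable (G x)) (c : (Fin n → Bool) → ℝ≥0∞)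
    (h : ∀ x (w : I), ENNReal.ofReal (likelihood x w) ≤ G x w + c x) :
    ENNReal.ofReal ρ ≤ bernoulliRisk n +
      ENNReal.ofReal ρ * ((∑ x, ∫⁻ w, G x w) + ENNReal.ofReal (2 * ρ) * ∑ x, c x) := by
  rw [← tsub_le_iff_right]
  refine le_iInf₂ fun φ _ => ?_
  rw [tsub_le_iff_right]
  have hL := measurable_absLoss_estimator φ
  change _ ≤ ∫⁻ z, absLoss z.1 (φ z.2) ∂(bernoulliJoint n) + _
  rw [lintegral_bernoulliJoint hL]
  let A : (Fin n → Bool) → Set I := fun x => {w | |(w : ℝ) - φ x| < ρ}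
  have hA : ∀ x, MeasurableSet (A x) := fun x =>
    (isOpen_lt (by fun_prop) continuous_const).measurableSet
  -- Inside the ball `A x` the domination of the likelihood is used; outside it the loss is at least
  -- `ρ`.
  have hpt : ∀ x (w : I), ENNReal.ofReal ρ * ENNReal.ofReal (likelihood x w) ≤
      absLoss w (φ x) * ENNReal.ofReal (likelihood x w) +
        ENNReal.ofReal ρ * (G x w + (A x).indicator (fun _ => c x) w) := by
    intro x w
    by_cases hw : w ∈ A x
    · rw [Set.indicator_of_mem hw]
      exact (mul_le_mul_right (h x w) _).trans le_add_self
    · refine le_add_right (mul_le_mul_left (ENNReal.ofReal_le_ofReal ?_) _)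
      simpa [A] using hw
  have hone : ∑ x : Fin n → Bool, ∫⁻ w : I, ENNReal.ofReal (likelihood x w) = 1 := by
    rw [← lintegral_finsetSum _ fun x _ => (measurable_likelihood x).ennreal_ofReal]
    simp [sum_ofReal_likelihood]
  calc ENNReal.ofReal ρ
      = ∑ x : Fin n → Bool, ∫⁻ w : I, ENNReal.ofReal ρ * ENNReal.ofReal (likelihood x w) := by
        simp_rw [lintegral_const_mul _ (measurable_likelihood _).ennreal_ofReal]
        rw [← Finset.mul_sum, hone, mul_one]
    _ ≤ ∑ x, ∫⁻ w : I, (absLoss w (φ x) * ENNReal.ofReal (likelihood x w) +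
        ENNReal.ofReal ρ * (G x w + (A x).indicator (fun _ => c x) w)) :=
        Finset.sum_le_sum fun x _ => lintegral_mono (hpt x)
    _ = ∑ x, (∫⁻ w : I, absLoss w (φ x) * ENNReal.ofReal (likelihood x w)) +
        ENNReal.ofReal ρ * ((∑ x, ∫⁻ w, G x w) + ∑ x, c x * volume (A x)) := by
        rw [← Finset.sum_add_distrib, Finset.mul_sum, ← Finset.sum_add_distrib]
        refine Finset.sum_congr rfl fun x _ => ?_
        have hm : Measurable fun w : I => absLoss w (φ x) * ENNReal.ofReal (likelihood x w) :=
          (hL.comp measurable_prodMk_right).mul (measurable_likelihood x).ennreal_ofReal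
        have hi : Measurable fun w => G x w + (A x).indicator (fun _ => c x) w :=
          (hG x).add (measurable_const.indicator (hA x))
        rw [lintegral_add_left hm, lintegral_const_mul _ hi, lintegral_add_left (hG x),
          lintegral_indicator_const (hA x)]
    _ ≤ _ := by
        rw [mul_comm (ENNReal.ofReal (2 * ρ)), Finset.sum_mul]
        gcongr with x _
        exact volume_abs_sub_lt_le _ _

/-- AM-GM gives `L ≤ L²/(3Sq) + (3S/4) q`, so the risk is at least `ρ (1 - 1/3 - 3Sρ/2)`, maximal at
`ρ = 2/(9S)`. The factor 3 is the best choice in this family of splittings. -/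
theorem ofReal_two_div_le_bernoulliRisk {n : ℕ} {S : ℝ} (hS : 0 < S)
    (h : ∑ x : Fin n → Bool, (∫⁻ w : I, ENNReal.ofReal (likelihood x w ^ 2)) /
      ENNReal.ofReal (evidence x) = ENNReal.ofReal S) :
    ENNReal.ofReal (2 / (27 * S)) ≤ bernoulliRisk n := by
  have hsum : ∑ x : Fin n → Bool, ENNReal.ofReal (evidence x) = 1 := by
    simp_rw [← lintegral_likelihood]
    rw [← lintegral_finsetSum _ fun x _ => (measurable_likelihood x).ennreal_ofReal]
    simp [sum_ofReal_likelihood]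
  have key := ofReal_le_bernoulliRisk_add (n := n) (ρ := 2 / (9 * S))
    (fun x w => ENNReal.ofReal (1 / (3 * S)) *
      (ENNReal.ofReal (likelihood x w ^ 2) / ENNReal.ofReal (evidence x)))
    (fun x => ((((measurable_likelihood x).pow_const 2).ennreal_ofReal).div_const _).const_mul _)
    (fun x => ENNReal.ofReal (3 * S / 4) * ENNReal.ofReal (evidence x))
    (fun x w => by
      have hq := evidence_pos x
      rw [← ENNReal.ofReal_div_of_pos hq, ← ENNReal.ofReal_mul (by positivity),
        ← ENNReal.ofReal_mul (by positivity), ← ENNReal.ofReal_add (by positivity) (by positivity)]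
      refine ENNReal.ofReal_le_ofReal ?_
      have e : 1 / (3 * S) * (likelihood x w ^ 2 / evidence x) + 3 * S / 4 * evidence x -
          likelihood x w = (2 * likelihood x w - 3 * S * evidence x) ^ 2 /
            (12 * S * evidence x) := by
        field_simp
        ring
      have : 0 ≤ (2 * likelihood x w - 3 * S * evidence x) ^ 2 / (12 * S * evidence x) := by
        positivity
      linarith)
  have hint : ∑ x : Fin n → Bool, ∫⁻ w : I, ENNReal.ofReal (1 / (3 * S)) *
      (ENNReal.ofReal (likelihood x w ^ 2) / ENNReal.ofReal (evidence x)) =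
      ENNReal.ofReal (1 / 3) := by
    have hm := fun x : Fin n → Bool => ((measurable_likelihood x).pow_const 2).ennreal_ofReal
    simp_rw [lintegral_const_mul _ ((hm _).div_const _), div_eq_mul_inv,
      lintegral_mul_const _ (hm _), ← div_eq_mul_inv]
    rw [← Finset.mul_sum, h, ← ENNReal.ofReal_mul (by positivity)]
    congr 1
    field_simp
  rw [hint, ← Finset.mul_sum, hsum, mul_one, ← ENNReal.ofReal_mul (by positivity),
    ← ENNReal.ofReal_add (by positivity) (by positivity), ← ENNReal.ofReal_mul (by positivity),
    ← tsub_le_iff_right, ← ENNReal.ofReal_sub _ (by positivity)] at key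
  convert! key using 2
  field_simp
  ring

/-- The likelihood at the maximum likelihood estimator. -/
noncomputable def maxLikelihood {n : ℕ} (x : Fin n → Bool) : ℝ :=
  (successCount x / n : ℝ) ^ successCount x *
    (((n - successCount x : ℕ) : ℝ) / n) ^ (n - successCount x)

theorem maxLikelihood_nonneg {n : ℕ} (x : Fin n → Bool) : 0 ≤ maxLikelihood x := by
  unfold maxLikelihood
  positivity

theorem likelihood_le_maxLikelihood {n : ℕ} (x : Fin n → Bool) (w : I) :
    likelihood x w ≤ maxLikelihood x := by
  have h := pow_mul_one_sub_pow_le (successCount x) (n - successCount x) w.2.1 w.2.2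
  rwa [Nat.add_sub_cancel' (successCount_le x)] at h

theorem sum_maxLikelihood_le {n : ℕ} (hn : 1 ≤ n) :
    ∑ x : Fin n → Bool, ENNReal.ofReal (maxLikelihood x) ≤
      ENNReal.ofReal (2 + √(Real.pi * n / 2)) := by
  rw [← ENNReal.ofReal_sum_of_nonneg fun x _ => maxLikelihood_nonneg x]
  refine ENNReal.ofReal_le_ofReal (le_trans (le_of_eq ?_) (sum_choose_mul_max_le hn))
  refine (sum_successCount n fun k =>
    (k / n : ℝ) ^ k * (((n - k : ℕ) : ℝ) / n) ^ (n - k)).trans ?_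
  exact Finset.sum_congr rfl fun k _ => nsmul_eq_mul _ _

/-- With `G = 0` and `c = M` the bound is `ρ (1 - 2ρS)`, maximal at `ρ = 1/(4S)`. -/
theorem ofReal_one_div_le_bernoulliRisk {n : ℕ} {S : ℝ} (hS : 0 < S)
    (h : ∑ x : Fin n → Bool, ENNReal.ofReal (maxLikelihood x) ≤ ENNReal.ofReal S) :
    ENNReal.ofReal (1 / (8 * S)) ≤ bernoulliRisk n := by
  have key := ofReal_le_bernoulliRisk_add (n := n) (ρ := 1 / (4 * S)) (fun _ _ => 0)
    (fun _ => measurable_const) (fun x => ENNReal.ofReal (maxLikelihood x))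
    (fun x w => by
      rw [zero_add]
      exact ENNReal.ofReal_le_ofReal (likelihood_le_maxLikelihood x w))
  simp only [lintegral_zero, Finset.sum_const_zero, zero_add] at key
  have key2 : ENNReal.ofReal (1 / (4 * S)) ≤ bernoulliRisk n + ENNReal.ofReal (1 / (4 * S)) *
      (ENNReal.ofReal (2 * (1 / (4 * S))) * ENNReal.ofReal S) := key.trans (by gcongr)
  rw [← ENNReal.ofReal_mul (by positivity), ← ENNReal.ofReal_mul (by positivity),
    ← tsub_le_iff_right, ← ENNReal.ofReal_sub _ (by positivity)] at key2
  convert! key2 using 2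
  field_simp
  ring

/-! ### The χ²-mutual information. -/

theorem fst_bernoulliJoint (n : ℕ) : (bernoulliJoint n).fst = volume :=
  Measure.fst_compProd _ _

theorem snd_bernoulliJoint_singleton {n : ℕ} (x : Fin n → Bool) :
    (bernoulliJoint n).snd {x} = ENNReal.ofReal (evidence x) := by
  rw [bernoulliJoint, Measure.snd_compProd, Measure.bind_apply (measurableSet_singleton x)
    (Kernel.aemeasurable _)]
  simp only [bernoulliSamples_singleton, lintegral_likelihood]

instance isProbabilityMeasure_bernoulliJoint (n : ℕ) :
    IsProbabilityMeasure (bernoulliJoint n) := by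
  unfold bernoulliJoint
  infer_instance

theorem lintegral_prod_marginals {n : ℕ} {f : I × (Fin n → Bool) → ℝ≥0∞} (hf : Measurable f) :
    ∫⁻ z, f z ∂((bernoulliJoint n).fst.prod (bernoulliJoint n).snd) =
      ∑ x, (∫⁻ w : I, f (w, x)) * ENNReal.ofReal (evidence x) := by
  rw [lintegral_prod_symm _ hf.aemeasurable, lintegral_fintype]
  simp only [fst_bernoulliJoint, snd_bernoulliJoint_singleton]

/-- The density of the joint law with respect to the product of its marginals. -/
noncomputable def jointDensity {n : ℕ} (z : I × (Fin n → Bool)) : ℝ :=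
  likelihood z.2 z.1 / evidence z.2

theorem jointDensity_nonneg {n : ℕ} (z : I × (Fin n → Bool)) : 0 ≤ jointDensity z :=
  div_nonneg (likelihood_nonneg _ _) (evidence_pos _).le

theorem measurable_jointDensity (n : ℕ) :
    Measurable (jointDensity : I × (Fin n → Bool) → ℝ) :=
  measurable_from_prod_countable_left fun x => (measurable_likelihood x).div_const (evidence x)

theorem bernoulliJoint_eq_withDensity (n : ℕ) :
    bernoulliJoint n = ((bernoulliJoint n).fst.prod (bernoulliJoint n).snd).withDensity
      fun z => ENNReal.ofReal (jointDensity z) := by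
  refine Measure.ext_of_lintegral _ fun f hf => ?_
  have hd := (measurable_jointDensity n).ennreal_ofReal
  rw [lintegral_withDensity_eq_lintegral_mul _ hd hf, lintegral_prod_marginals (hd.mul hf),
    lintegral_bernoulliJoint hf]
  refine Finset.sum_congr rfl fun x _ => ?_
  have hm : Measurable fun w : I =>
      ((fun z : I × (Fin n → Bool) => ENNReal.ofReal (jointDensity z)) * f) (w, x) :=
    (hd.mul hf).comp measurable_prodMk_right
  rw [← lintegral_mul_const _ hm]
  refine lintegral_congr fun w => ?_
  have hq := evidence_pos x
  simp only [Pi.mul_apply, jointDensity]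
  rw [mul_right_comm, ← ENNReal.ofReal_mul (div_nonneg (likelihood_nonneg x w) hq.le),
    div_mul_cancel₀ _ hq.ne', mul_comm]

theorem chiSqInfo_bernoulliJoint_add_one (n : ℕ) :
    chiSqInfo (bernoulliJoint n) + 1 =
      ENNReal.ofReal (((n : ℝ) + 1) / (2 * n + 1) * (4 ^ n / ((2 * n).choose n : ℝ))) := by
  have hd := measurable_jointDensity n
  have hJ := bernoulliJoint_eq_withDensity n
  set Q := (bernoulliJoint n).fst.prod (bernoulliJoint n).snd with hQ
  have hac : bernoulliJoint n ≪ Q := by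
    rw [hJ]
    exact withDensity_absolutelyContinuous _ _
  have hrn : (bernoulliJoint n).rnDeriv Q =ᵐ[Q] fun z => ENNReal.ofReal (jointDensity z) := by
    have := Measure.rnDeriv_withDensity Q hd.ennreal_ofReal
    rwa [← hJ] at this
  have hchi : chiSqInfo (bernoulliJoint n) =
      ∫⁻ z, ENNReal.ofReal ((jointDensity z - 1) ^ 2) ∂Q := by
    rw [chiSqInfo, ← hQ, chiSqDiv, if_pos hac]
    refine lintegral_congr_ae ?_
    filter_upwards [hrn] with z hz
    rw [hz, ENNReal.toReal_ofReal (jointDensity_nonneg z)]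
  have hmass : ∫⁻ z, ENNReal.ofReal (jointDensity z) ∂Q = 1 := by
    have h := measure_univ (μ := bernoulliJoint n)
    rwa [hJ, withDensity_apply _ MeasurableSet.univ, setLIntegral_univ] at h
  have hsq : ∫⁻ z, ENNReal.ofReal (jointDensity z ^ 2) ∂Q =
      ENNReal.ofReal (((n : ℝ) + 1) / (2 * n + 1) * (4 ^ n / ((2 * n).choose n : ℝ))) := by
    rw [← sum_lintegral_likelihood_sq_div, hQ,
      lintegral_prod_marginals (hd.pow_const 2).ennreal_ofReal]
    refine Finset.sum_congr rfl fun x _ => ?_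
    have hq := evidence_pos x
    have hm := ((measurable_likelihood x).pow_const 2).ennreal_ofReal
    have hm' : Measurable fun w : I => ENNReal.ofReal (jointDensity (w, x) ^ 2) :=
      (hd.pow_const 2).ennreal_ofReal.comp measurable_prodMk_right
    rw [← lintegral_mul_const _ hm', div_eq_mul_inv, ← lintegral_mul_const _ hm]
    refine lintegral_congr fun w => ?_
    rw [← div_eq_mul_inv, ← ENNReal.ofReal_div_of_pos hq,
      ← ENNReal.ofReal_mul (sq_nonneg _), jointDensity]
    congr 1
    field_simp
  -- Expanding the square as `(d-1)² + 2d = d² + 1` avoids subtraction in `ℝ≥0∞`; the density `d`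
  -- has integral 1.
  have hadd : (∫⁻ z, ENNReal.ofReal ((jointDensity z - 1) ^ 2) ∂Q) + 2 =
      (∫⁻ z, ENNReal.ofReal (jointDensity z ^ 2) ∂Q) + 1 := by
    have e : ∀ z : I × (Fin n → Bool), ENNReal.ofReal ((jointDensity z - 1) ^ 2) +
        2 * ENNReal.ofReal (jointDensity z) = ENNReal.ofReal (jointDensity z ^ 2) + 1 := by
      intro z
      have h0 := jointDensity_nonneg z
      rw [← ENNReal.ofReal_ofNat 2, ← ENNReal.ofReal_mul (by norm_num),
        ← ENNReal.ofReal_add (sq_nonneg _) (by positivity), ← ENNReal.ofReal_one,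
        ← ENNReal.ofReal_add (sq_nonneg _) zero_le_one]
      congr 1
      ring
    have h := lintegral_congr (μ := Q) e
    rw [lintegral_add_right _ (hd.ennreal_ofReal.const_mul 2),
      lintegral_const_mul _ hd.ennreal_ofReal, hmass, mul_one,
      lintegral_add_right _ measurable_const, lintegral_one, measure_univ] at h
    exact h
  rw [hchi, ← hsq]
  rw [show (2 : ℝ≥0∞) = 1 + 1 from one_add_one_eq_two.symm, ← add_assoc] at hadd
  exact (ENNReal.add_left_inj ENNReal.one_ne_top).1 hadd

/-! ### Maximal leakage. -/

/-- Replacing `L` by `M` bounds the conditional probability of `Û = u` given `W = w` by `∑ x, D x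
{u} * M x`, free of `w`. Averaging over `W` leaves the law of `U`, at most its maximum; summing over
`u` removes `D`, as each `D x` has mass 1. -/
theorem maximalLeakage_bernoulliSamples_le {n : ℕ} {S : ℝ} (hS : 0 < S)
    (h : ∑ x : Fin n → Bool, ENNReal.ofReal (maxLikelihood x) ≤ ENNReal.ofReal S) :
    maximalLeakage (volume : Measure I) (bernoulliSamples n) ≤ ((Real.log S : ℝ) : EReal) := by
  refine iSup_le fun m => iSup_le fun K => iSup_le fun _ => iSup_le fun D => iSup_le fun _ => ?_
  rw [show ((Real.log S : ℝ) : EReal) = ENNReal.log (ENNReal.ofReal S) by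
    rw [ENNReal.log_ofReal, if_neg hS.not_ge]]
  refine ENNReal.log_le_log (ENNReal.div_le_of_le_mul ?_)
  have hset : MeasurableSet {p : Fin m × Fin m | p.1 = p.2} := MeasurableSet.of_discrete
  have hKm : ∀ u, Measurable fun w : I => K w {u} := fun u =>
    K.measurable_coe (measurableSet_singleton u)
  have hKu : ∀ u : Fin m, (K ∘ₘ (volume : Measure I)) {u} = ∫⁻ w, K w {u} := fun u =>
    Measure.bind_apply (measurableSet_singleton u) K.aemeasurable
  have hcomp : ∀ (w : I) u, (D ∘ₖ bernoulliSamples n) w {u} ≤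
      ∑ x, D x {u} * ENNReal.ofReal (maxLikelihood x) := by
    intro w u
    rw [Kernel.comp_apply' _ _ _ (measurableSet_singleton u), lintegral_fintype]
    refine Finset.sum_le_sum fun x _ => ?_
    rw [bernoulliSamples_singleton]
    gcongr
    exact likelihood_le_maxLikelihood x w
  rw [Measure.bind_apply hset (Kernel.aemeasurable _)]
  calc ∫⁻ w : I, (K ×ₖ (D ∘ₖ bernoulliSamples n)) w {p | p.1 = p.2}
      ≤ ∫⁻ w : I, ∑ u, (∑ x, D x {u} * ENNReal.ofReal (maxLikelihood x)) * K w {u} := by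
        refine lintegral_mono fun w => ?_
        dsimp only
        rw [Kernel.prod_apply' _ _ _ hset, lintegral_fintype]
        refine Finset.sum_le_sum fun u _ => ?_
        gcongr
        refine le_trans (measure_mono ?_) (hcomp w u)
        intro v hv
        exact (Set.mem_singleton_iff.2 (Eq.symm hv))
    _ = ∑ u, (∑ x, D x {u} * ENNReal.ofReal (maxLikelihood x)) *
        (K ∘ₘ (volume : Measure I)) {u} := by
        rw [lintegral_finsetSum _ fun u _ => (hKm u).const_mul _]
        simp_rw [lintegral_const_mul _ (hKm _), hKu]
    _ ≤ ∑ u, (∑ x, D x {u} * ENNReal.ofReal (maxLikelihood x)) *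
        ⨆ u : Fin m, (K ∘ₘ (volume : Measure I)) {u} := by
        gcongr with u _
        exact le_iSup (fun u : Fin m => (K ∘ₘ (volume : Measure I)) {u}) u
    _ = (∑ x : Fin n → Bool, ENNReal.ofReal (maxLikelihood x)) *
        ⨆ u : Fin m, (K ∘ₘ (volume : Measure I)) {u} := by
        rw [← Finset.sum_mul, Finset.sum_comm]
        congr 1
        refine Finset.sum_congr rfl fun x _ => ?_
        rw [← Finset.sum_mul, sum_measure_singleton, Finset.coe_univ, measure_univ, one_mul]
    _ ≤ _ := by gcongr

/-! ### Risk of the sample mean and conclusion. -/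

theorem sampleMean_eq {n : ℕ} (x : Fin n → Bool) : sampleMean n x = successCount x / n := by
  simp [sampleMean, successCount]

theorem sum_sq_sub_sampleMean_mul_likelihood {n : ℕ} (hn : n ≠ 0) (w : I) :
    ∑ x : Fin n → Bool, ((w : ℝ) - sampleMean n x) ^ 2 * likelihood x w =
      (w : ℝ) * (1 - w) / n := by
  rw [← bernstein.variance hn w]
  simp only [sampleMean_eq, bernstein_apply, bernstein.z]
  rw [← Finset.sum_range (fun k => ((w : ℝ) - k / n) ^ 2 *
    ((n.choose k : ℝ) * (w : ℝ) ^ k * (1 - (w : ℝ)) ^ (n - k)))]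
  refine (sum_successCount n fun k =>
    ((w : ℝ) - k / n) ^ 2 * ((w : ℝ) ^ k * (1 - (w : ℝ)) ^ (n - k))).trans ?_
  refine Finset.sum_congr rfl fun k _ => ?_
  rw [nsmul_eq_mul]
  ring

theorem lintegral_absLoss_sampleMean_le {n : ℕ} (hn : 1 ≤ n) :
    ∫⁻ z, absLoss z.1 (sampleMean n z.2) ∂(bernoulliJoint n) ≤
      ENNReal.ofReal (1 / √(6 * n)) := by
  have hnp : (0 : ℝ) < n := by exact_mod_cast hn
  set s := √(6 * n) with hs
  have hsp : 0 < s := by positivity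
  have hss : s ^ 2 = 6 * n := Real.sq_sqrt (by positivity)
  have hL := measurable_absLoss_estimator (sampleMean n)
  have hm : ∀ x : Fin n → Bool, Measurable fun w : I =>
      absLoss w (sampleMean n x) * ENNReal.ofReal (likelihood x w) := fun x =>
    (hL.comp measurable_prodMk_right).mul (measurable_likelihood x).ennreal_ofReal
  rw [lintegral_bernoulliJoint hL, ← lintegral_finsetSum _ fun x _ => hm x]
  have hpt : ∀ w : I, ∑ x, absLoss w (sampleMean n x) * ENNReal.ofReal (likelihood x w) ≤
      ENNReal.ofReal (s / (2 * n)) * ENNReal.ofReal ((w : ℝ) ^ 1 * (1 - w) ^ 1) +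
        ENNReal.ofReal (1 / (2 * s)) := by
    intro w
    have h0 := w.2.1
    have h1 := sub_nonneg.2 w.2.2
    simp only [absLoss, ← ENNReal.ofReal_mul (abs_nonneg _)]
    rw [← ENNReal.ofReal_sum_of_nonneg fun x _ =>
      mul_nonneg (abs_nonneg _) (likelihood_nonneg x w), ← ENNReal.ofReal_mul (by positivity),
      ← ENNReal.ofReal_add (by positivity) (by positivity)]
    refine ENNReal.ofReal_le_ofReal ?_
    -- A linearised Cauchy-Schwarz: `d ≤ s d²/2 + 1/(2s)`. The mean square error is `(1/n) ∫ w(1-w)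
    -- = 1/(6n) = 1/s²`, so both terms contribute `1/(2s)`.
    have hb : ∀ x : Fin n → Bool, |(w : ℝ) - sampleMean n x| * likelihood x w ≤
        s / 2 * (((w : ℝ) - sampleMean n x) ^ 2 * likelihood x w) +
          1 / (2 * s) * likelihood x w := by
      intro x
      rw [← mul_assoc, ← add_mul]
      refine mul_le_mul_of_nonneg_right ?_ (likelihood_nonneg x w)
      rw [← sq_abs]
      set d := |(w : ℝ) - sampleMean n x|
      have e : s / 2 * d ^ 2 + 1 / (2 * s) - d = (s * d - 1) ^ 2 / (2 * s) := by
        field_simp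
        ring
      have : 0 ≤ (s * d - 1) ^ 2 / (2 * s) := by positivity
      linarith
    refine (Finset.sum_le_sum fun x _ => hb x).trans (le_of_eq ?_)
    rw [Finset.sum_add_distrib, ← Finset.mul_sum, ← Finset.mul_sum, sum_likelihood,
      sum_sq_sub_sampleMean_mul_likelihood (by lia)]
    field_simp
  refine (lintegral_mono hpt).trans (le_of_eq ?_)
  rw [lintegral_add_right _ measurable_const, lintegral_const_mul _ (by fun_prop),
    lintegral_pow_mul_one_sub_pow, lintegral_const, measure_univ, mul_one,
    ← ENNReal.ofReal_mul (by positivity), ← ENNReal.ofReal_add (by positivity) (by positivity)]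
  congr 1
  norm_num [Nat.factorial]
  field_simp
  rw [hss]
  ring

theorem exists_pos_mul_one_div_sqrt_le :
    ∃ c : ℝ, 0 < c ∧ ∀ n : ℕ, 1 ≤ n →
      c * (1 / √(6 * n)) ≤ 7 / (72 * √(Real.pi * n)) ∧
      c * (1 / √(6 * n)) ≤ 1 / (8 * (2 + √(Real.pi * n / 2))) := by
  -- Any small constant works; with `√6 ≥ 2`, `√π ≤ 2` and `√n ≥ 1`, the value `1/20` makes both
  -- inequalities linear in `√n`.
  refine ⟨1 / 20, by norm_num, fun n hn => ?_⟩
  have hn1 : (1 : ℝ) ≤ n := by exact_mod_cast hn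
  have hp := Real.pi_pos
  have hp4 := Real.pi_le_four
  have hr1 : 1 ≤ √(n : ℝ) := Real.one_le_sqrt.2 hn1
  have h6 : 2 ≤ √6 := Real.le_sqrt_of_sq_le (by norm_num)
  have h6n : 2 * √(n : ℝ) ≤ √(6 * n) := by
    rw [Real.sqrt_mul (by norm_num)]
    gcongr
  have hpn : √(Real.pi * n) ≤ 2 * √(n : ℝ) := by
    rw [Real.sqrt_mul hp.le]
    gcongr
    exact Real.sqrt_le_iff.2 ⟨by norm_num, by linarith⟩
  have hpn2 : √(Real.pi * n / 2) ≤ 2 * √(n : ℝ) := by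
    refine le_trans (Real.sqrt_le_sqrt ?_) hpn
    have : 0 < Real.pi * n := by positivity
    linarith
  have hpn0 : 0 < √(Real.pi * n) := Real.sqrt_pos.2 (by positivity)
  have h0 : 0 < √(6 * (n : ℝ)) := by linarith
  constructor
  · rw [mul_one_div, div_le_div_iff₀ h0 (by positivity)]
    linarith
  · rw [mul_one_div, div_le_div_iff₀ h0 (by positivity)]
    linarith

theorem mainTheorem8 :
    (∀ n : ℕ, 1 ≤ n →
      chiSqInfo (bernoulliJoint n) + 1 =
          ENNReal.ofReal (((n : ℝ) + 1) / (2 * n + 1) * (4 ^ n / ((2 * n).choose n : ℝ))) ∧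
      ((n : ℝ) + 1) / (2 * n + 1) * (4 ^ n / ((2 * n).choose n : ℝ)) ≤
          16 * √(Real.pi * n) / 21 ∧
      ENNReal.ofReal (2 / 27) / (chiSqInfo (bernoulliJoint n) + 1) ≤ bernoulliRisk n ∧
      ENNReal.ofReal (7 / (72 * √(Real.pi * n))) ≤
          ENNReal.ofReal (2 / 27) / (chiSqInfo (bernoulliJoint n) + 1) ∧
      maximalLeakage (volume : Measure I) (bernoulliSamples n) ≤
          ((Real.log (2 + √(Real.pi * n / 2)) : ℝ) : EReal) ∧
      ENNReal.ofReal (1 / (8 * (2 + √(Real.pi * n / 2)))) ≤ bernoulliRisk n ∧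
      ∫⁻ z, absLoss z.1 (sampleMean n z.2) ∂(bernoulliJoint n) ≤
          ENNReal.ofReal (1 / √(6 * n)) ∧
      bernoulliRisk n ≤ ENNReal.ofReal (1 / √(6 * n))) ∧
    (∃ c : ℝ, 0 < c ∧ ∀ n : ℕ, 1 ≤ n →
      c * (1 / √(6 * n)) ≤ 7 / (72 * √(Real.pi * n)) ∧
      c * (1 / √(6 * n)) ≤ 1 / (8 * (2 + √(Real.pi * n / 2)))) := by
  refine ⟨fun n hn => ?_, exists_pos_mul_one_div_sqrt_le⟩
  have hnp : (0 : ℝ) < n := by exact_mod_cast hn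
  have hS := chiSqInfo_bernoulliJoint_add_one n
  have hle := succ_div_mul_four_pow_div_choose_le hn
  have hR := sum_lintegral_likelihood_sq_div n
  have hpos : 0 < ((n : ℝ) + 1) / (2 * n + 1) * (4 ^ n / ((2 * n).choose n : ℝ)) := by
    have : (0 : ℝ) < (2 * n).choose n := by exact_mod_cast Nat.choose_pos (by lia)
    positivity
  set S := ((n : ℝ) + 1) / (2 * n + 1) * (4 ^ n / ((2 * n).choose n : ℝ))
  have hdiv : ENNReal.ofReal (2 / 27) / ENNReal.ofReal S = ENNReal.ofReal (2 / (27 * S)) := by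
    rw [← ENNReal.ofReal_div_of_pos hpos, div_div]
  have hmean := lintegral_absLoss_sampleMean_le hn
  refine ⟨hS, hle, ?_, ?_, maximalLeakage_bernoulliSamples_le (by positivity)
    (sum_maxLikelihood_le hn), ofReal_one_div_le_bernoulliRisk (by positivity)
    (sum_maxLikelihood_le hn), hmean,
    (iInf₂_le (sampleMean n) Measurable.of_discrete).trans hmean⟩
  · rw [hS, hdiv]
    exact ofReal_two_div_le_bernoulliRisk hpos hR
  · rw [hS, hdiv]
    -- The constant is `7/72 = (2/27)(21/16)`, from the upper bound on `S`.
    refine ENNReal.ofReal_le_ofReal ?_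
    have hsq : 0 < √(Real.pi * n) := Real.sqrt_pos.2 (by positivity)
    rw [div_le_div_iff₀ (by positivity) (by positivity)]
    linarith
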